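/- Let $(\Omega,\mathcal F,\mathbb P)$ be a probability space with a right-continuous filtration $(\mathcal F_t)_{t\ge 0}$ (not necessarily augmented by null sets), and let $\mathcal F_\infty=\bigvee_{t\ge 0}\mathcal F_t$. Let $X=(X_t)_{t\ge 0}$ be an adapted $\mathbb R^d$-valued process all of whose paths are càdlàg. A process $Y$ with values in a metric space is called globally sticky if $\mathbb P\big(\sup_{t\in[\tau,\infty)} d(Y_t,Y_\tau)\le\varepsilon \,\big|\, \mathcal F_\tau\big)>0$ almost surely for every stopping time $\tau:\Omega\to[0,\infty]$ and every strictly positive $\mathcal F_\tau$-measurable real random variable $\varepsilon$ (on $\{\tau=\infty\}$ the supremum is over the empty set and equals $-\infty$). $X$ is called sticky if the stopped process $(X_{t\wedge T})_{t\ge0}$ is globally sticky for every $T\in[0,\infty)$. Let $\mathrm{CO}(\mathbb R^d)$ be the complete lattice of all closed convex subsets of $\mathbb R^d$ (including $\emptyset$), ordered by inclusion, with infima given by intersections and suprema by closed convex hulls of unions. It is equipped with the Borel $\sigma$-algebra of the extended Wijsman topology, that is, of the coarsest topology for which all the maps $C\mapsto d(x,C)\in[0,\infty]$, $x\in\mathbb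 R^d$, are continuous, where $d(x,\emptyset)=\infty$. For a random element $V$ of $\mathrm{CO}(\mathbb R^d)$ and a sub-$\sigma$-algebra $\mathcal E\subseteq\mathcal F$, the conditional infimum $\bigwedge[V\mid\mathcal E]$ is the almost surely unique $\mathcal E$-measurable random element of $\mathrm{CO}(\mathbb R^d)$ with $\bigwedge[V\mid\mathcal E]\le V$ almost surely and $Z\le\bigwedge[V\mid\mathcal E]$ almost surely for every $\mathcal E$-measurable random element $Z$ with $Z\le V$ almost surely. Define $U_t=\overline{\mathrm{conv}}(X_s\colon s\le t)$, the closed convex hull of the path of $X$ up to time $t$. If $X$ is sticky, then the $\mathrm{CO}(\mathbb R^d)$-valued process $U=(U_t)_{t\ge0}$ is adapted, and $$U_t=\bigwedge[U_T\mid\mathcal F_t]\quad\text{almost surely, for all } 0\le t\le T<\infty.$$ -/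

import Mathlib

open MeasureTheory Filter Topology
open scoped NNReal ENNReal

/-- `ClosedConvex d` is the collection `CO(ℝ^d)` of all closed convex subsets of the Euclidean
space `ℝ^d`, the empty set included. -/
@[ext]
structure ClosedConvex (d : ℕ) where
  /-- The underlying set. -/
  carrier : Set (EuclideanSpace ℝ (Fin d))
  convex : Convex ℝ carrier
  isClosed : IsClosed carrier

namespace ClosedConvex

variable {d : ℕ}

/-- `CO(ℝ^d)` is ordered by inclusion. -/
instance : PartialOrder (ClosedConvex d) :=
  PartialOrder.lift carrier fun _ _ h => ClosedConvex.ext h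

/-- The closed convex hull `cl conv A` of a set `A`, as an element of `CO(ℝ^d)`. -/
def hull (A : Set (EuclideanSpace ℝ (Fin d))) : ClosedConvex d where
  carrier := closedConvexHull ℝ A
  convex := convex_closedConvexHull
  isClosed := isClosed_closedConvexHull

/-- The infimum of a family of closed convex sets is its intersection. -/
instance : InfSet (ClosedConvex d) where
  sInf S :=
    { carrier := ⋂ C ∈ S, C.carrier
      convex := convex_iInter₂ fun C _ => C.convex
      isClosed := isClosed_biInter fun C _ => C.isClosed }

/-- The supremum of a family of closed convex sets is the closed convex hull of its union. -/
instance : SupSet (ClosedConvex d) where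
  sSup S := hull (⋃ C ∈ S, C.carrier)

theorem isGLB_sInf' (S : Set (ClosedConvex d)) : IsGLB S (sInf S) :=
  ⟨fun _ hC => Set.biInter_subset_of_mem hC, fun _ hB => Set.subset_iInter₂ fun _ hC => hB hC⟩

theorem isLUB_sSup' (S : Set (ClosedConvex d)) : IsLUB S (sSup S) :=
  ⟨fun _ hC => (Set.subset_biUnion_of_mem hC).trans subset_closedConvexHull,
    fun B hB => closedConvexHull_min (Set.iUnion₂_subset fun _ hC => hB hC) B.convex B.isClosed⟩

/-- The complete lattice `CO(ℝ^d)`. -/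
instance : CompleteLattice (ClosedConvex d) where
  __ := completeLatticeOfInf (ClosedConvex d) isGLB_sInf'
  sSup := sSup
  isLUB_sSup := isLUB_sSup'

/-- The (extended) Wijsman topology: the coarsest topology for which all the distance functions
`C ↦ d(x, C)` are continuous. Here `d(x, ∅) = ∞`, so that `Cₙ → ∅` means that `d(x, Cₙ) → ∞` for
every `x`, while on nonempty sets the distances are finite. -/
noncomputable instance : TopologicalSpace (ClosedConvex d) :=
  ⨅ x : EuclideanSpace ℝ (Fin d),
    TopologicalSpace.induced (fun C : ClosedConvex d => Metric.infEDist x C.carrier) inferInstance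

/-- `CO(ℝ^d)` carries the Borel σ-algebra of the Wijsman topology. -/
noncomputable instance : MeasurableSpace (ClosedConvex d) := borel _

instance : BorelSpace (ClosedConvex d) := ⟨rfl⟩

end ClosedConvex

/-- `V` is (a version of) the conditional infimum `⋀[X | 𝓔]`: it is the greatest, up to null sets,
among the `𝓔`-measurable random elements that are almost surely below `X`. -/
structure IsCondInf {Ω S : Type*} [MeasurableSpace Ω] [CompleteLattice S] [MeasurableSpace S]
    (P : Measure Ω) (𝓔 : MeasurableSpace Ω) (X V : Ω → S) : Prop where
  measurable : Measurable[𝓔] V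
  le : V ≤ᵐ[P] X
  greatest : ∀ Z : Ω → S, Measurable[𝓔] Z → Z ≤ᵐ[P] X → Z ≤ᵐ[P] V

/-- All paths are right-continuous with left limits. -/
def IsCadlagProcess {Ω E : Type*} [TopologicalSpace E] (X : ℝ≥0 → Ω → E) : Prop :=
  ∀ ω t, ContinuousWithinAt (fun s => X s ω) (Set.Ici t) t ∧
    ∃ l, Tendsto (fun s => X s ω) (𝓝[<] t) (𝓝 l)

/-- The event `sup_{t ∈ [τ, ∞)} d(X_t, X_τ) ≤ ε`; it contains `{τ = ∞}`. -/
def stayEvent {Ω E : Type*} [PseudoMetricSpace E] (X : ℝ≥0 → Ω → E)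
    (τ : Ω → WithTop ℝ≥0) (ε : Ω → ℝ) : Set Ω :=
  {ω | ∀ s t : ℝ≥0, τ ω = s → s ≤ t → dist (X t ω) (X s ω) ≤ ε ω}

/-- Global stickiness: `P(sup_{t ∈ [τ, ∞)} d(X_t, X_τ) ≤ ε | 𝓕_τ) > 0` almost surely, for every
stopping time `τ` and every strictly positive `𝓕_τ`-measurable random variable `ε`. -/
def IsGloballySticky {Ω E : Type*} [mΩ : MeasurableSpace Ω] [PseudoMetricSpace E]
    (P : Measure Ω) (𝓕 : Filtration ℝ≥0 mΩ) (X : ℝ≥0 → Ω → E) : Prop :=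
  ∀ (τ : Ω → WithTop ℝ≥0) (hτ : IsStoppingTime 𝓕 τ) (ε : Ω → ℝ),
    Measurable[hτ.measurableSpace] ε → (∀ ω, 0 < ε ω) →
      ∀ᵐ ω ∂P, 0 < (P[(stayEvent X τ ε).indicator (fun _ => (1 : ℝ)) | hτ.measurableSpace]) ω

/-- Stickiness: for every deterministic time `T`, the stopped process `X^T = (X_{t ∧ T})` is
globally sticky. -/
def IsSticky {Ω E : Type*} [mΩ : MeasurableSpace Ω] [PseudoMetricSpace E]
    (P : Measure Ω) (𝓕 : Filtration ℝ≥0 mΩ) (X : ℝ≥0 → Ω → E) : Prop :=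
  ∀ T : ℝ≥0, IsGloballySticky P 𝓕 (fun t => X (min t T))

/-- The process of closed convex hulls `U_t = cl conv(X_s : s ≤ t)`. -/
def hullProcess {Ω : Type*} {d : ℕ} (X : ℝ≥0 → Ω → EuclideanSpace ℝ (Fin d)) :
    ℝ≥0 → Ω → ClosedConvex d :=
  fun t ω => ClosedConvex.hull ((fun s => X s ω) '' Set.Iic t)

/-!
`U_t` is an `𝓕_t`-measurable lower bound of `U_T`; what needs proof is that it is the greatest one.
On the event that `X` stays within `ε` of `X_t` during `[t, T]`, the set `U_T` lies in the closed
`ε`-neighbourhood of `U_t`, so that an `𝓕_t`-measurable `Z ≤ U_T` satisfies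
`d(x, U_t) ≤ d(x, Z) + ε` there. The latter inequality defines an `𝓕_t`-measurable event, and by
stickiness the former event has positive conditional probability given `𝓕_t`; hence the inequality
holds almost surely. Letting `ε → 0` along a sequence and `x` run through a countable dense set
gives `Z ≤ U_t`.

For adaptedness, right-continuity allows us to replace the path by its restriction to countably
many times, and the distance to the convex hull of countably many points is an infimum over
countably many convex combinations.
-/

section PseudoEMetric

variable {E : Type*} [PseudoEMetricSpace E] {D : Set E}

theorem infEDist_eq_iInf_dense (hD : Dense D) (A : Set E) (x : E) :
    Metric.infEDist x A = ⨅ y : D, (Metric.infEDist (y : E) A + edist x y) := by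
  rw [hD.ciInf' (f := fun y => Metric.infEDist y A + edist x y)
    (Metric.continuous_infEDist.add (continuous_const.edist continuous_id))]
  exact le_antisymm (le_iInf fun y => Metric.infEDist_le_infEDist_add_edist)
    (iInf_le_of_le x (by simp))

theorem subset_iff_forall_dense_infEDist_le (hD : Dense D) {A B : Set E} (hB : IsClosed B) :
    A ⊆ B ↔ ∀ y ∈ D, Metric.infEDist y B ≤ Metric.infEDist y A := by
  refine ⟨fun h y _ => Metric.infEDist_anti h, fun h x hx => ?_⟩
  have hle : Metric.infEDist x B ≤ Metric.infEDist x A :=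
    (isClosed_le Metric.continuous_infEDist Metric.continuous_infEDist).closure_subset_iff.2 h
      (hD x)
  rw [Metric.mem_iff_infEDist_zero_of_closed hB, ← nonpos_iff_eq_zero]
  exact hle.trans (Metric.infEDist_zero_of_mem hx).le

theorem infEDist_le_add_of_subset_cthickening {A B : Set E} {ε : ℝ}
    (h : A ⊆ Metric.cthickening ε B) (x : E) :
    Metric.infEDist x B ≤ Metric.infEDist x A + ENNReal.ofReal ε :=
  Metric.infEDist_le_infEDist_cthickening_add.trans (by gcongr)

end PseudoEMetric

section PseudoMetric

variable {E : Type*} [PseudoMetricSpace E] {D : Set E}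

theorem infEDist_eq_iSup_dense (hD : Dense D) (A : Set E) (x : E) :
    Metric.infEDist x A = ⨆ y : D, (Metric.infEDist (y : E) A - edist (y : E) x) := by
  have hcont : Continuous fun y => Metric.infEDist y A - edist y x :=
    continuous_iff_continuousAt.2 fun y =>
      ENNReal.Tendsto.sub Metric.continuous_infEDist.continuousAt
        (continuous_id.edist continuous_const).continuousAt (.inr (edist_ne_top y x))
  rw [hD.ciSup' hcont]
  exact le_antisymm (le_iSup_of_le x (by simp))
    (iSup_le fun y => tsub_le_iff_right.2 Metric.infEDist_le_infEDist_add_edist)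

theorem continuous_infEDist_of_dense {α : Type*} [TopologicalSpace α] (hD : Dense D)
    {K : α → Set E} (hK : ∀ y ∈ D, Continuous fun a => Metric.infEDist y (K a)) (x : E) :
    Continuous fun a => Metric.infEDist x (K a) := by
  refine continuous_iff_lower_upperSemicontinuous.2 ⟨?_, ?_⟩
  · simp_rw [infEDist_eq_iSup_dense hD _ x]
    exact lowerSemicontinuous_iSup fun y =>
      ((ENNReal.continuous_sub_right _).comp (hK y y.2)).lowerSemicontinuous
  · simp_rw [infEDist_eq_iInf_dense hD _ x]
    exact upperSemicontinuous_iInf fun y => ((hK y y.2).add continuous_const).upperSemicontinuous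

theorem iInf_induced_infEDist_eq_induced_dense {α : Type*} (hD : Dense D) (K : α → Set E) :
    ⨅ x, TopologicalSpace.induced (fun a => Metric.infEDist x (K a)) inferInstance =
      TopologicalSpace.induced (fun a (y : D) => Metric.infEDist (y : E) (K a)) inferInstance := by
  refine le_antisymm ?_ (le_iInf fun x => continuous_iff_le_induced.1 ?_)
  · let : TopologicalSpace α :=
      ⨅ x, TopologicalSpace.induced (fun a => Metric.infEDist x (K a)) inferInstance
    exact continuous_iff_le_induced.1 (continuous_pi fun y =>
      continuous_iInf_dom (i := (y : E)) continuous_induced_dom)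
  · let : TopologicalSpace α :=
      TopologicalSpace.induced (fun a (y : D) => Metric.infEDist (y : E) (K a)) inferInstance
    have hind : Continuous fun a (y : D) => Metric.infEDist (y : E) (K a) := continuous_induced_dom
    exact continuous_infEDist_of_dense hD (fun y hy => continuous_pi_iff.1 hind ⟨y, hy⟩) x

end PseudoMetric

section ConvexHull

variable {E : Type*} [SeminormedAddCommGroup E] [NormedSpace ℝ E]

theorem closedConvexHull_subset_cthickening {A B : Set E} {ε : ℝ}
    (h : B ⊆ Metric.cthickening ε A) :
    closedConvexHull ℝ B ⊆ Metric.cthickening ε (closedConvexHull ℝ A) :=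
  closedConvexHull_min (h.trans (Metric.cthickening_subset_of_subset _ subset_closedConvexHull))
    (convex_closedConvexHull.cthickening ε) Metric.isClosed_cthickening

theorem infEDist_convexHull_range {ι : Type*} (f : ι → E) (x : E) :
    Metric.infEDist x (convexHull ℝ (Set.range f)) =
      ⨅ s : Finset ι, ⨅ w : stdSimplex ℝ s, edist x (∑ i, (w : s → ℝ) i • f i) := by
  refine le_antisymm (le_iInf₂ fun s w => Metric.infEDist_le_edist_of_mem ?_) ?_
  · exact mem_convexHull_of_exists_fintype (w : s → ℝ) (fun i => f i) w.2.1 w.2.2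
      (fun i => ⟨i, rfl⟩) rfl
  · refine Metric.le_infEDist.2 fun y hy => ?_
    rw [convexHull_range_eq_exists_affineCombination] at hy
    obtain ⟨s, w, hw₀, hw₁, rfl⟩ := hy
    have hw : (fun i : s => w i) ∈ stdSimplex ℝ s :=
      ⟨fun i => hw₀ i i.2, (Finset.sum_coe_sort s w).trans hw₁⟩
    refine iInf₂_le_of_le s ⟨_, hw⟩ (le_of_eq ?_)
    rw [Finset.affineCombination_eq_linear_combination _ _ _ hw₁]
    exact congrArg _ (Finset.sum_coe_sort s fun i => w i • f i)

theorem measurable_infEDist_convexHull_range [SecondCountableTopology E] [MeasurableSpace E]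
    [BorelSpace E] {Ω ι : Type*} {m : MeasurableSpace Ω} [Countable ι] {f : ι → Ω → E}
    (hf : ∀ i, Measurable (f i)) (x : E) :
    Measurable fun ω => Metric.infEDist x (convexHull ℝ (Set.range fun i => f i ω)) := by
  simp_rw [infEDist_convexHull_range]
  refine Measurable.iInf fun s => ?_
  obtain ⟨D, hDc, hD⟩ := TopologicalSpace.exists_countable_dense (stdSimplex ℝ s)
  have : Countable D := hDc
  have hcont (ω : Ω) :
      Continuous fun w : stdSimplex ℝ s => edist x (∑ i, (w : s → ℝ) i • f i ω) :=
    continuous_const.edist <| continuous_finsetSum _ fun i _ =>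
      ((continuous_apply i).comp continuous_subtype_val).smul continuous_const
  simp_rw [← hD.ciInf' (hcont _)]
  exact Measurable.iInf fun w => measurable_const.edist
    (Finset.measurable_sum _ fun i _ => (hf i).const_smul _)

end ConvexHull

section RightContinuousPaths

variable {ι E : Type*} [LinearOrder ι] [TopologicalSpace ι] [OrderTopology ι] [DenselyOrdered ι]

theorem closure_image_Iic_inter_dense [TopologicalSpace E] {x : ι → E}
    (hx : ∀ s, ContinuousWithinAt x (Set.Ici s) s) {D : Set ι} (hD : Dense D) {t : ι}
    (ht : t ∈ D) : closure (x '' (Set.Iic t ∩ D)) = closure (x '' Set.Iic t) := by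
  refine subset_antisymm (closure_mono (Set.image_mono Set.inter_subset_left))
    (closure_minimal ?_ isClosed_closure)
  rintro _ ⟨s, hst, rfl⟩
  obtain rfl | hst := eq_or_lt_of_le (Set.mem_Iic.1 hst)
  · exact subset_closure ⟨s, ⟨Set.self_mem_Iic, ht⟩, rfl⟩
  · have hs : s ∈ closure (Set.Ioo s t ∩ D) := by
      refine closure_minimal (hD.open_subset_closure_inter isOpen_Ioo) isClosed_closure ?_
      rw [closure_Ioo hst.ne]
      exact Set.left_mem_Icc.2 hst.le
    have hsub : Set.Ioo s t ∩ D ⊆ Set.Iic t ∩ D := fun r hr => ⟨hr.1.2.le, hr.2⟩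
    have hxs := ((hx s).mono (s := Set.Ioo s t ∩ D) fun r hr => hr.1.1.le).mem_closure_image hs
    exact closure_mono (Set.image_mono hsub) hxs

theorem measurable_infEDist_closedConvexHull_image_Iic [TopologicalSpace.SeparableSpace ι]
    [SeminormedAddCommGroup E] [NormedSpace ℝ E] [SecondCountableTopology E] [MeasurableSpace E]
    [BorelSpace E] {Ω : Type*} {m : MeasurableSpace Ω} {X : ι → Ω → E} {t : ι}
    (hX : ∀ s ≤ t, Measurable (X s))
    (hXr : ∀ ω s, ContinuousWithinAt (fun r => X r ω) (Set.Ici s) s) (x : E) :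
    Measurable fun ω => Metric.infEDist x (closedConvexHull ℝ ((fun s => X s ω) '' Set.Iic t)) := by
  obtain ⟨D, hDc, hD⟩ := TopologicalSpace.exists_countable_dense ι
  set S : Set ι := Set.Iic t ∩ insert t D
  have : Countable S := ((hDc.insert t).mono Set.inter_subset_right).to_subtype
  have hhull (ω : Ω) : closedConvexHull ℝ ((fun s => X s ω) '' Set.Iic t) =
      closure (convexHull ℝ (Set.range fun s : S => X s ω)) := by
    rw [← closedConvexHull_closure_eq_closedConvexHull, ← closure_image_Iic_inter_dense (hXr ω)
      (hD.mono (Set.subset_insert t D)) (Set.mem_insert t D),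
      closedConvexHull_closure_eq_closedConvexHull, closedConvexHull_eq_closure_convexHull,
      Set.image_eq_range]
  simp_rw [hhull, Metric.infEDist_closure]
  exact measurable_infEDist_convexHull_range (fun s : S => hX s s.2.1) x

end RightContinuousPaths

theorem ae_mem_of_condExp_indicator_pos {Ω : Type*} {m mΩ : MeasurableSpace Ω} {P : Measure Ω}
    (hm : m ≤ mΩ) {A B : Set Ω} (hB : MeasurableSet[m] B) (hAB : ∀ᵐ ω ∂P, ω ∈ A → ω ∈ B)
    (hA : ∀ᵐ ω ∂P, 0 < (P[A.indicator (fun _ => (1 : ℝ)) | m]) ω) : ∀ᵐ ω ∂P, ω ∈ B := by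
  have hzero : A.indicator (fun _ => (1 : ℝ)) =ᵐ[P.restrict Bᶜ] 0 := by
    refine (ae_restrict_iff' (hm _ hB.compl)).2 ?_
    filter_upwards [hAB] with ω hω hωB using Set.indicator_of_notMem (mt hω hωB) _
  have hcond := (ae_restrict_iff' (hm _ hB.compl)).1 (condExp_ae_eq_restrict_zero hB.compl hzero)
  filter_upwards [hA, hcond] with ω hpos hω
  by_contra hωB
  exact hpos.ne' (hω hωB)

namespace ClosedConvex

variable {d : ℕ} {Ω : Type*}

theorem measurable_iff_infEDist {m : MeasurableSpace Ω} {V : Ω → ClosedConvex d} :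
    Measurable V ↔ ∀ x, Measurable fun ω => Metric.infEDist x (V ω).carrier := by
  refine ⟨fun hV x => ?_, fun hV => ?_⟩
  · have hcont : Continuous fun C : ClosedConvex d => Metric.infEDist x C.carrier :=
      continuous_iInf_dom (i := x) continuous_induced_dom
    exact hcont.measurable.comp hV
  · obtain ⟨D, hDc, hD⟩ := TopologicalSpace.exists_countable_dense (EuclideanSpace ℝ (Fin d))
    have : Countable D := hDc
    have hborel : (instMeasurableSpace : MeasurableSpace (ClosedConvex d)) =
        MeasurableSpace.comap (fun C (y : D) => Metric.infEDist (y : EuclideanSpace ℝ (Fin d))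
          C.carrier) MeasurableSpace.pi := by
      refine (congrArg (@borel _) (iInf_induced_infEDist_eq_induced_dense hD carrier)).trans ?_
      rw [borel_comap, BorelSpace.measurable_eq (α := D → ℝ≥0∞)]
    rw [measurable_iff_comap_le, hborel, MeasurableSpace.comap_comp, ← measurable_iff_comap_le]
    exact measurable_pi_iff.2 fun y => hV y

theorem isCondInf_of_condExp_pos {m mΩ : MeasurableSpace Ω} {P : Measure Ω}
    (hm : m ≤ mΩ) {U V : Ω → ClosedConvex d} (hV : Measurable[m] V) (hVU : V ≤ᵐ[P] U)
    {A : ℝ → Set Ω}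
    (hAU : ∀ ε > 0, ∀ ω ∈ A ε, (U ω).carrier ⊆ Metric.cthickening ε (V ω).carrier)
    (hA : ∀ ε > 0, ∀ᵐ ω ∂P, 0 < (P[(A ε).indicator (fun _ => (1 : ℝ)) | m]) ω) :
    IsCondInf P m U V := by
  refine ⟨hV, hVU, fun Z hZ hZU => ?_⟩
  have hdist {ε : ℝ} (hε : 0 < ε) (x : EuclideanSpace ℝ (Fin d)) : ∀ᵐ ω ∂P,
      Metric.infEDist x (V ω).carrier ≤ Metric.infEDist x (Z ω).carrier + ENNReal.ofReal ε := by
    have hmeas := measurableSet_le (measurable_iff_infEDist.1 hV x)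
      ((measurable_iff_infEDist.1 hZ x).add_const (ENNReal.ofReal ε))
    refine ae_mem_of_condExp_indicator_pos hm hmeas ?_ (hA ε hε)
    filter_upwards [hZU] with ω hω hωA
    exact infEDist_le_add_of_subset_cthickening (Set.Subset.trans hω (hAU ε hε ω hωA)) x
  obtain ⟨u, -, hu, hlim⟩ := exists_seq_strictAnti_tendsto (0 : ℝ)
  obtain ⟨D, hDc, hD⟩ := TopologicalSpace.exists_countable_dense (EuclideanSpace ℝ (Fin d))
  have hall : ∀ᵐ ω ∂P, ∀ y ∈ D, ∀ n, Metric.infEDist y (V ω).carrier ≤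
      Metric.infEDist y (Z ω).carrier + ENNReal.ofReal (u n) :=
    (ae_ball_iff hDc).2 fun y _ => ae_all_iff.2 fun n => hdist (hu n) y
  filter_upwards [hall] with ω hω
  refine (subset_iff_forall_dense_infEDist_le hD (V ω).isClosed).2 fun y hy => ?_
  refine ge_of_tendsto' (x := atTop) ?_ (hω y hy)
  simpa using (ENNReal.tendsto_ofReal hlim).const_add (Metric.infEDist y (Z ω).carrier)

end ClosedConvex

/-- Stickiness tested at deterministic times and for deterministic radii only: given the
information at time `t`, the process stays within `ε` of its current position up to time `T` with
positive conditional probability. -/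
def IsStickyAtConstTimes {Ω ι E : Type*} [mΩ : MeasurableSpace Ω] [Preorder ι]
    [PseudoMetricSpace E] (P : Measure Ω) (𝓕 : Filtration ι mΩ) (X : ι → Ω → E) : Prop :=
  ∀ t T : ι, t ≤ T → ∀ ε > 0, ∀ᵐ ω ∂P,
    0 < (P[{ω | ∀ s ∈ Set.Icc t T, dist (X s ω) (X t ω) ≤ ε}.indicator
      (fun _ => (1 : ℝ)) | 𝓕 t]) ω

theorem IsSticky.isStickyAtConstTimes {Ω E : Type*} [mΩ : MeasurableSpace Ω]
    [PseudoMetricSpace E] {P : Measure Ω} {𝓕 : Filtration ℝ≥0 mΩ} {X : ℝ≥0 → Ω → E}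
    (hX : IsSticky P 𝓕 X) : IsStickyAtConstTimes P 𝓕 X := by
  intro t T htT ε hε
  have hstay : stayEvent (fun s => X (min s T)) (fun _ => (t : WithTop ℝ≥0)) (fun _ => ε) =
      {ω | ∀ s ∈ Set.Icc t T, dist (X s ω) (X t ω) ≤ ε} := by
    ext ω
    constructor
    · rintro h s ⟨hts, hsT⟩
      simpa only [min_eq_left hsT, min_eq_left htT] using h t s rfl hts
    · intro h r s hr hrs
      obtain rfl : t = r := WithTop.coe_injective hr
      simpa only [min_eq_left htT] using h (min s T) ⟨le_min hrs htT, min_le_right s T⟩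
  have hpos := hX T (fun _ => t) (isStoppingTime_const 𝓕 t) (fun _ => ε) measurable_const
    fun _ => hε
  rwa [hstay, IsStoppingTime.measurableSpace_const] at hpos

section HullProcess

variable {Ω : Type*} {d : ℕ} {X : ℝ≥0 → Ω → EuclideanSpace ℝ (Fin d)}

theorem monotone_hullProcess : Monotone (hullProcess X) := fun _ _ h _ =>
  (closedConvexHull ℝ).monotone (Set.image_mono (Set.Iic_subset_Iic.2 h))

theorem hullProcess_subset_cthickening {t T : ℝ≥0} {ω : Ω} {ε : ℝ}
    (h : ∀ s ∈ Set.Icc t T, dist (X s ω) (X t ω) ≤ ε) :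
    (hullProcess X T ω).carrier ⊆ Metric.cthickening ε (hullProcess X t ω).carrier := by
  refine closedConvexHull_subset_cthickening ?_
  rintro _ ⟨s, hsT, rfl⟩
  obtain hst | hts := le_total s t
  · exact Metric.self_subset_cthickening _ ⟨s, hst, rfl⟩
  · exact Metric.mem_cthickening_of_dist_le _ _ _ _ ⟨t, Set.self_mem_Iic, rfl⟩ (h s ⟨hts, hsT⟩)

theorem adapted_hullProcess [mΩ : MeasurableSpace Ω] {𝓕 : Filtration ℝ≥0 mΩ} (hX : Adapted 𝓕 X)
    (hXr : ∀ ω s, ContinuousWithinAt (fun r => X r ω) (Set.Ici s) s) :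
    Adapted 𝓕 (hullProcess X) := fun _ =>
  ClosedConvex.measurable_iff_infEDist.2 <| measurable_infEDist_closedConvexHull_image_Iic
    (fun s hst => (hX s).mono (𝓕.mono hst) le_rfl) hXr

end HullProcess

theorem propositionP_general {Ω : Type*} [mΩ : MeasurableSpace Ω] {P : Measure Ω}
    {𝓕 : Filtration ℝ≥0 mΩ} [SigmaFiniteFiltration P 𝓕] {d : ℕ}
    {X : ℝ≥0 → Ω → EuclideanSpace ℝ (Fin d)} (hXadapted : Adapted 𝓕 X)
    (hXright : ∀ ω t, ContinuousWithinAt (fun s => X s ω) (Set.Ici t) t)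
    (hXsticky : IsStickyAtConstTimes P 𝓕 X) :
    Adapted 𝓕 (hullProcess X) ∧
      ∀ t T : ℝ≥0, t ≤ T → IsCondInf P (𝓕 t) (hullProcess X T) (hullProcess X t) := by
  have hadapted := adapted_hullProcess hXadapted hXright
  exact ⟨hadapted, fun t T htT => ClosedConvex.isCondInf_of_condExp_pos (𝓕.le t)
    (hadapted t) (.of_forall (monotone_hullProcess htT))
    (fun _ _ _ => hullProcess_subset_cthickening) (hXsticky t T htT)⟩

/-- The process of closed convex hulls of a sticky càdlàg process is adapted, and it is recovered
from its value at any later time `T` by taking conditional infima in `CO(ℝ^d)`. -/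
theorem propositionP {Ω : Type*} [mΩ : MeasurableSpace Ω] (P : Measure Ω) [IsProbabilityMeasure P]
    (𝓕 : Filtration ℝ≥0 mΩ) [𝓕.IsRightContinuous] (d : ℕ)
    (X : ℝ≥0 → Ω → EuclideanSpace ℝ (Fin d)) (hXadapted : Adapted 𝓕 X)
    (hXcadlag : IsCadlagProcess X) (hXsticky : IsSticky P 𝓕 X) :
    Adapted 𝓕 (hullProcess X) ∧
      ∀ t T : ℝ≥0, t ≤ T → IsCondInf P (𝓕 t) (hullProcess X T) (hullProcess X t) :=
  propositionP_general hXadapted (fun ω t => (hXcadlag ω t).1) hXsticky.isStickyAtConstTimes
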